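/- Let $\rho(x)=\dfrac{1}{|x|(1+x)\left(\left(\log\frac{1+x}{|x|}\right)^2+\pi^2\right)}$ for $x\in(-1,0)$. Then for every $z\in\mathbb{C}\setminus[-1,0]$ the function $x\mapsto\log|z-x|\,\rho(x)$ is integrable on $(-1,0)$ and $$\int_{-1}^0\log|z-x|\,\rho(x)\,dx=-\log\left|\log\frac{1+z}{z}\right|,$$ where the inner logarithm on the right, $\log\frac{1+z}{z}$, is the principal branch of the complex logarithm. -/

import Mathlib

/-- The limiting zero density of the geometric polynomials, given on `(-1,0)` by
`ρ(x) = 1 / ((1+x) |x| ((log ((1+x)/|x|))² + π²))`. (It is only used on `(-1,0)`.) -/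
noncomputable def geometricZeroDensity (x : ℝ) : ℝ :=
  1 / ((1 + x) * |x| * (Real.log ((1 + x) / |x|) ^ 2 + Real.pi ^ 2))

open Complex MeasureTheory Filter Topology Set

/-! The substitution `t = log ((1+x)/|x|)` maps `(-1,0)` onto `ℝ` and turns `ρ(x) dx` into the
Cauchy probability law `dt / (t² + π²)`. With `w = log ((1+z)/z)` one has `z - x = z (1+x) (1 +
e^(w-t))` and `1 + x = 1 / (1 + e^(-t))`, so the claim reduces to `∫ logKernel w = log |(e^w -
1)/w|` (`integral_logKernel`), because `z (e^w - 1) = 1`.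

Both sides of that identity vanish at `w = 0`, so it is enough to compare derivatives along the
segment `r w`. This requires the Cauchy average of the Fermi function `1 / (1 + e^(t-w))`. Up to the
factor `2πi`, the density `1/(t² + π²)` is the difference of the Cauchy kernels on the lines `Im s =
±π`. Since `e^(t ± πi) = -e^t`, the Fermi function is the boundary value of `1 / (1 - e^(s-w))` on
both lines. Cauchy's theorem, with the pole at `s = w` cancelled, gives `1/(1 - e^(-w)) - 1/w`, the
logarithmic derivative of `(e^w - 1)/w`. -/

/-! ### Cauchy kernels on the boundary of a strip -/

theorem integrable_inv_sq_add_sq {c : ℝ} (hc : 0 < c) (d : ℝ) :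
    Integrable fun t : ℝ => (c ^ 2 + (t + d) ^ 2)⁻¹ := by
  have h := ((integrable_inv_one_add_sq.comp_mul_right' (R := c⁻¹) (by positivity)).comp_add_right
    d).const_mul (c ^ 2)⁻¹
  refine h.congr (Eventually.of_forall fun t => ?_)
  simp only
  rw [← mul_inv]
  congr 1
  field_simp

/-- Each term decays only like `1/t`; over a common denominator the `t` cancels from the numerator,
leaving `O(1/t²)`. -/
theorem integrable_poisson_kernel {p q : ℂ} (hp : 0 < p.re) (hq : 0 < q.re) :
    Integrable fun t : ℝ => I / (p + t * I) + I / (q - t * I) := by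
  have hp0 : ∀ t : ℝ, p + t * I ≠ 0 := fun t h => by
    have := congrArg re h; simp at this; linarith
  have hq0 : ∀ t : ℝ, q - t * I ≠ 0 := fun t h => by
    have := congrArg re h; simp at this; linarith
  have hb := ((integrable_inv_sq_add_sq hp p.im).add
    (integrable_inv_sq_add_sq hq (-q.im))).const_mul ‖p + q‖
  refine hb.mono' (Continuous.aestronglyMeasurable ?_) (Eventually.of_forall fun t => ?_)
  · exact (continuous_const.div (by fun_prop) hp0).add (continuous_const.div (by fun_prop) hq0)
  have e : I / (p + t * I) + I / (q - t * I) = I * (p + q) * ((p + t * I)⁻¹ * (q - t * I)⁻¹) := by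
    rw [← mul_inv, div_add_div _ _ (hp0 t) (hq0 t), div_eq_mul_inv]; congr 1; ring
  have n1 : p.re ^ 2 + (t + p.im) ^ 2 = ‖p + t * I‖ ^ 2 := by
    rw [← normSq_eq_norm_sq, normSq_apply]; simp; ring
  have n2 : q.re ^ 2 + (t + -q.im) ^ 2 = ‖q - t * I‖ ^ 2 := by
    rw [← normSq_eq_norm_sq, normSq_apply]; simp; ring
  rw [e, norm_mul, norm_mul, norm_I, one_mul, norm_mul, norm_inv, norm_inv]
  refine mul_le_mul_of_nonneg_left ?_ (norm_nonneg _)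
  simp only [Pi.add_apply]
  rw [n1, n2, ← inv_pow, ← inv_pow]
  nlinarith [sq_nonneg (‖p + t * I‖⁻¹ - ‖q - t * I‖⁻¹), sq_nonneg (‖p + t * I‖⁻¹),
    sq_nonneg (‖q - t * I‖⁻¹), sq_nonneg (‖p + t * I‖⁻¹ + ‖q - t * I‖⁻¹)]

theorem tendsto_log_div_add {p : ℂ} {c : ℂ} (hc : c ∈ slitPlane) :
    Tendsto (fun t : ℝ => log (p / t + c)) atTop (𝓝 (log c)) := by
  have h : Tendsto (fun t : ℝ => p / t + c) atTop (𝓝 c) := by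
    have h1 : Tendsto (fun t : ℝ => ((t⁻¹ : ℝ) : ℂ)) atTop (𝓝 ((0 : ℝ) : ℂ)) :=
      (continuous_ofReal.tendsto 0).comp tendsto_inv_atTop_zero
    have := (h1.const_mul p).add_const c
    simpa [div_eq_mul_inv] using this
  exact (continuousAt_clog hc).tendsto.comp h

theorem log_add_mul_I_sub {p q : ℂ} (hp : 0 < p.re) (hq : 0 < q.re) {t : ℝ} (ht : 0 < t) :
    log (p + t * I) - log (q - t * I) = log (p / t + I) - log (q / t + -I) := by
  have ht' : (t : ℂ) ≠ 0 := by exact_mod_cast ht.ne'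
  have e1 : p + t * I = t * (p / t + I) := by field_simp
  have e2 : q - t * I = t * (q / t + -I) := by field_simp; ring
  have h1 : p / t + I ≠ 0 := fun h => by
    have := congrArg re h; simp at this; rcases this with h | h <;> linarith
  have h2 : q / t + -I ≠ 0 := fun h => by
    have := congrArg re h; simp at this; rcases this with h | h <;> linarith
  rw [e1, e2, log_ofReal_mul ht h1, log_ofReal_mul ht h2]
  ring

/-- An antiderivative is `log (p + t I) - log (q - t I)`; positive real parts keep both arguments
off the branch cut. At infinity the `log t` terms cancel, leaving `log I - log (-I) = π I`. -/
theorem integral_poisson_kernel {p q : ℂ} (hp : 0 < p.re) (hq : 0 < q.re) :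
    ∫ t : ℝ, (I / (p + t * I) + I / (q - t * I)) = 2 * Real.pi * I := by
  have hI : I ∈ slitPlane := Or.inr (by simp)
  have hI' : -I ∈ slitPlane := Or.inr (by simp)
  have key : ∀ {p q : ℂ}, 0 < p.re → 0 < q.re →
      Tendsto (fun t : ℝ => log (p + t * I) - log (q - t * I)) atTop (𝓝 (Real.pi * I)) := by
    intro p q hp hq
    have h := (tendsto_log_div_add (p := p) hI).sub (tendsto_log_div_add (p := q) hI')
    rw [log_I, log_neg_I] at h
    have e : (Real.pi / 2 * I - -(Real.pi / 2) * I : ℂ) = Real.pi * I := by ring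
    rw [e] at h
    refine h.congr' ?_
    filter_upwards [eventually_gt_atTop 0] with t ht
    exact (log_add_mul_I_sub hp hq ht).symm
  have h := integral_of_hasDerivAt_of_tendsto
    (f := fun t : ℝ => log (p + t * I) - log (q - t * I)) (n := Real.pi * I) (m := -(Real.pi * I))
    (f' := fun t : ℝ => I / (p + t * I) + I / (q - t * I)) ?_
    (integrable_poisson_kernel hp hq) ?_ (key hp hq)
  · rw [h]; ring
  · intro t
    have d : HasDerivAt (fun t : ℝ => (t : ℂ) * I) I t := by
      simpa using (hasDerivAt_id t).ofReal_comp.mul_const I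
    have d1 := (d.const_add p).clog_real (Or.inl (by simpa using hp))
    have d2 := (d.const_sub q).clog_real (Or.inl (by simpa using hq))
    convert d1.sub d2 using 1
    · rfl
    · rw [neg_div, sub_neg_eq_add]
  -- Replacing `t` by `-t` swaps `p` and `q` and changes the sign.
  · have := ((key hq hp).neg).comp tendsto_neg_atBot_atTop
    refine this.congr fun t => ?_
    simp [sub_eq_add_neg]

/-- The difference of the Cauchy kernels of the two boundary lines of the strip `|Im s| < π`. -/
noncomputable def stripKernel (a : ℂ) (t : ℝ) : ℂ :=
  (t - Real.pi * I - a)⁻¹ - (t + Real.pi * I - a)⁻¹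

theorem stripKernel_eq (a : ℂ) : stripKernel a =
    fun t : ℝ => I / ((Real.pi - a * I) + t * I) + I / ((Real.pi + a * I) - t * I) := by
  funext t
  have e1 : (Real.pi - a * I) + t * I = I * (t - Real.pi * I - a) := by
    linear_combination (Real.pi : ℂ) * I_sq
  have e2 : (Real.pi + a * I) - t * I = -I * (t + Real.pi * I - a) := by
    linear_combination (Real.pi : ℂ) * I_sq
  rw [e1, e2, div_mul_eq_div_div, div_mul_eq_div_div, div_self I_ne_zero, div_neg, div_self I_ne_zero,
    stripKernel, one_div, neg_div, one_div, sub_eq_add_neg]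

theorem integrable_stripKernel {a : ℂ} (ha : |a.im| < Real.pi) : Integrable (stripKernel a) := by
  rw [stripKernel_eq]
  exact integrable_poisson_kernel (by simp; linarith [neg_abs_le a.im])
    (by simp; linarith [le_abs_self a.im])

theorem integral_stripKernel {a : ℂ} (ha : |a.im| < Real.pi) :
    ∫ t, stripKernel a t = 2 * Real.pi * I := by
  rw [stripKernel_eq]
  exact integral_poisson_kernel (by simp; linarith [neg_abs_le a.im])
    (by simp; linarith [le_abs_self a.im])

theorem stripKernel_zero (t : ℝ) :
    stripKernel 0 t = 2 * Real.pi * I * ((t ^ 2 + Real.pi ^ 2)⁻¹ : ℝ) := by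
  have h1 : (t - Real.pi * I : ℂ) ≠ 0 := fun h => by
    have := congrArg im h; simp [Real.pi_ne_zero] at this
  have h2 : (t + Real.pi * I : ℂ) ≠ 0 := fun h => by
    have := congrArg im h; simp [Real.pi_ne_zero] at this
  have e : ((t ^ 2 + Real.pi ^ 2 : ℝ) : ℂ) = (t - Real.pi * I) * (t + Real.pi * I) := by
    push_cast
    linear_combination (Real.pi : ℂ) ^ 2 * I_sq
  rw [stripKernel, sub_zero, sub_zero, ofReal_inv, e, inv_sub_inv h1 h2, div_eq_mul_inv]
  congr 1
  ring

/-! ### The functions `(e^u - 1)/u` and `1/(1 - e^u) + 1/u` -/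

/-- The entire function `u ↦ (exp u - 1) / u`. -/
noncomputable def expSlope : ℂ → ℂ := dslope exp 0

theorem expSlope_zero : expSlope 0 = 1 := by
  rw [expSlope, dslope_same]; simp

theorem mul_expSlope (u : ℂ) : u * expSlope u = exp u - 1 := by
  simpa [expSlope] using sub_smul_dslope exp 0 u

theorem differentiable_expSlope : Differentiable ℂ expSlope := by
  have := (Complex.differentiableOn_dslope (f := exp) (c := 0) (s := univ) univ_mem).2
    differentiable_exp.differentiableOn
  exact differentiableOn_univ.1 this

theorem exp_ne_one_of_abs_im_lt {u : ℂ} (hu : |u.im| < 2 * Real.pi) (h0 : u ≠ 0) : exp u ≠ 1 := by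
  intro h
  obtain ⟨n, hn⟩ := exp_eq_one_iff.1 h
  have him : u.im = n * (2 * Real.pi) := by rw [hn]; simp
  rw [him, abs_mul, abs_of_pos Real.two_pi_pos] at hu
  have hlt : |(n : ℝ)| < 1 := by nlinarith [Real.two_pi_pos]
  have hn0 : n = 0 := by
    rw [← Int.cast_abs] at hlt
    exact Int.abs_lt_one_iff.1 (by exact_mod_cast hlt)
  exact h0 (by rw [hn, hn0]; simp)

theorem expSlope_ne_zero {u : ℂ} (hu : |u.im| < 2 * Real.pi) : expSlope u ≠ 0 := by
  rcases eq_or_ne u 0 with rfl | h0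
  · rw [expSlope_zero]; exact one_ne_zero
  · intro h
    have := mul_expSlope u
    rw [h, mul_zero] at this
    exact exp_ne_one_of_abs_im_lt hu h0 (sub_eq_zero.1 this.symm)

/-- The function `u ↦ 1 / (1 - exp u) + 1 / u`, with its removable singularity at `0` removed. -/
noncomputable def fermiRegular (u : ℂ) : ℂ := dslope expSlope 0 u / expSlope u

theorem fermiRegular_eq {u : ℂ} (h0 : u ≠ 0) (h1 : exp u ≠ 1) :
    fermiRegular u = (1 - exp u)⁻¹ + u⁻¹ := by
  have h2 : exp u - 1 ≠ 0 := sub_ne_zero.2 h1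
  have h3 : 1 - exp u ≠ 0 := sub_ne_zero.2 h1.symm
  have e : expSlope u = (exp u - 1) / u := by
    rw [← mul_expSlope]; field_simp
  rw [fermiRegular, dslope_of_ne _ h0, slope_def_field, expSlope_zero, e]
  field_simp
  ring

/-- The width `2π` accommodates `u = s - w` with `|Im s| ≤ π` and `|Im w| < π`. -/
theorem differentiableOn_fermiRegular :
    DifferentiableOn ℂ fermiRegular {u | |u.im| < 2 * Real.pi} := by
  have := (Complex.differentiableOn_dslope (f := expSlope) (c := 0) (s := univ) univ_mem).2
    differentiable_expSlope.differentiableOn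
  exact (this.mono (subset_univ _)).div differentiable_expSlope.differentiableOn
    fun u hu => expSlope_ne_zero hu

/-- Away from the imaginary axis `|1 - e^u| ≥ |1 - e^(Re u)| ≥ 1/2`, so the two terms contribute at
most `2` and `1`. -/
theorem norm_fermiRegular_le {u : ℂ} (hu : 1 ≤ |u.re|) : ‖fermiRegular u‖ ≤ 3 := by
  have h0 : u ≠ 0 := by rintro rfl; simp at hu; linarith
  have hk : 1 / 2 ≤ ‖1 - exp u‖ := by
    have h1 := abs_norm_sub_norm_le (1 : ℂ) (exp u)
    rw [norm_exp, norm_one] at h1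
    refine le_trans ?_ h1
    have he := Real.add_one_le_exp 1
    rcases le_abs.1 hu with h | h
    · have := Real.exp_le_exp.2 h
      rw [abs_of_nonpos (by linarith)]; linarith
    · have h2 := Real.exp_le_exp.2 (show u.re ≤ -1 by linarith)
      rw [Real.exp_neg] at h2
      have h3 : (Real.exp 1)⁻¹ ≤ 1 / 2 := by
        rw [one_div]; exact inv_anti₀ (by norm_num) (by linarith)
      refine le_trans ?_ (le_abs_self _); linarith
  have h1 : exp u ≠ 1 := by
    intro h; rw [h, sub_self, norm_zero] at hk; linarith
  rw [fermiRegular_eq h0 h1]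
  have hu1 : 1 ≤ ‖u‖ := hu.trans (abs_re_le_norm u)
  calc _ ≤ ‖(1 - exp u)⁻¹‖ + ‖u⁻¹‖ := norm_add_le _ _
    _ ≤ (1 / 2)⁻¹ + 1⁻¹ := by
        rw [norm_inv, norm_inv]
        exact add_le_add (inv_anti₀ (by norm_num) hk) (inv_anti₀ one_pos hu1)
    _ = 3 := by norm_num

/-! ### Contour integration and the average of the Fermi function -/

/-- Cauchy's theorem on the rectangles `[-T, T] × [-π, π]`, as `T → ∞`. -/
theorem tendsto_integral_strip_boundary {h : ℂ → ℂ}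
    (hd : DifferentiableOn ℂ h {s | |s.im| ≤ Real.pi}) {C R : ℝ}
    (hb : ∀ s : ℂ, R ≤ |s.re| → |s.im| ≤ Real.pi → ‖h s‖ ≤ C / |s.re|) :
    Tendsto (fun T : ℝ => ∫ t in (-T)..T, (h (t - Real.pi * I) - h (t + Real.pi * I)))
      atTop (𝓝 0) := by
  have hpi := Real.pi_pos
  have hc : ∀ c : ℝ, |c| ≤ Real.pi → Continuous fun t : ℝ => h (t + c * I) := fun c hc =>
    hd.continuousOn.comp_continuous (by fun_prop) fun t => by simpa using hc
  have hc1 : Continuous fun t : ℝ => h (t - Real.pi * I) := by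
    simpa [sub_eq_add_neg] using hc (-Real.pi) (by rw [abs_neg, abs_of_pos hpi])
  have hc2 := hc Real.pi (abs_of_pos hpi).le
  have hv : ∀ x : ℝ, R ≤ |x| → ‖∫ y in (-Real.pi)..Real.pi, h (x + y * I)‖
      ≤ C / |x| * (2 * Real.pi) := by
    intro x hx
    have := intervalIntegral.norm_integral_le_of_norm_le_const (a := -Real.pi) (b := Real.pi)
      (f := fun y : ℝ => h (x + y * I)) (C := C / |x|) (fun y hy => by
        rw [uIoc_of_le (by linarith)] at hy
        have := hb (x + y * I) (by simpa using hx) (by simpa using abs_le.2 ⟨hy.1.le, hy.2⟩)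
        simpa using this)
    rwa [show |Real.pi - -Real.pi| = 2 * Real.pi by rw [abs_of_pos] <;> linarith] at this
  have hlim : Tendsto (fun T : ℝ => 2 * (C / T * (2 * Real.pi))) atTop (𝓝 0) := by
    have := ((tendsto_const_nhds (x := C)).div_atTop tendsto_id).mul_const (2 * Real.pi)
    simpa using this.const_mul 2
  refine squeeze_zero_norm' ?_ hlim
  filter_upwards [eventually_gt_atTop 0, eventually_ge_atTop R] with T hT hTR
  have hr := integral_boundary_rect_eq_zero_of_differentiableOn h
    (-T - Real.pi * I) (T + Real.pi * I) (hd.mono fun s hs => by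
      have := hs.2
      simp only [mem_preimage, sub_im, neg_im, ofReal_im, mul_im, ofReal_re, I_im, I_re, add_im,
        mul_one, mul_zero, add_zero, neg_zero, zero_sub, zero_add] at this
      rw [uIcc_of_le (by linarith)] at this
      exact abs_le.2 this)
  simp only [sub_im, sub_re, neg_im, neg_re, ofReal_im, mul_im, mul_re, ofReal_re, I_im, I_re,
    add_im, add_re, mul_one, mul_zero, add_zero, neg_zero, zero_sub, zero_add, sub_zero,
    smul_eq_mul, ofReal_neg, sub_self] at hr
  rw [intervalIntegral.integral_sub (hc1.intervalIntegrable _ _) (hc2.intervalIntegrable _ _)]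
  have h1 := hv T (by rwa [abs_of_pos hT])
  have h2 := hv (-T) (by rwa [abs_neg, abs_of_pos hT])
  rw [abs_neg] at h2
  rw [abs_of_pos hT] at h1 h2
  have e : (∫ t in (-T)..T, h (t - Real.pi * I)) - ∫ t in (-T)..T, h (t + Real.pi * I) =
      I * ((∫ y in (-Real.pi)..Real.pi, h ((-T : ℝ) + y * I)) -
        ∫ y in (-Real.pi)..Real.pi, h ((T : ℝ) + y * I)) := by
    simp only [ofReal_neg, neg_mul, ← sub_eq_add_neg] at hr ⊢
    linear_combination hr
  rw [e, norm_mul, norm_I, one_mul]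
  exact (norm_sub_le _ _).trans (by linarith)

/-- For `u = x + iy`, `|1 + e^u|² = cos²(y/2) (1 + e^x)² + sin²(y/2) (1 - e^x)²`; drop the second
term. -/
theorem cos_half_mul_le_norm_one_add_exp {u : ℂ} {b : ℝ} (hu : |u.im| ≤ b) (hb : b ≤ Real.pi) :
    Real.cos (b / 2) * (1 + Real.exp u.re) ≤ ‖1 + exp u‖ := by
  have hc : Real.cos (b / 2) ≤ Real.cos (u.im / 2) := by
    rw [← Real.cos_abs (u.im / 2), abs_div, abs_two]
    exact Real.cos_le_cos_of_nonneg_of_le_pi (by positivity) (by linarith [Real.pi_pos])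
      (by linarith)
  refine (mul_le_mul_of_nonneg_right hc (by positivity)).trans ?_
  refine le_of_abs_le (abs_le_of_sq_le_sq ?_ (norm_nonneg _))
  have e : ‖1 + exp u‖ ^ 2 = 1 + 2 * Real.exp u.re * Real.cos u.im + Real.exp u.re ^ 2 := by
    rw [← normSq_eq_norm_sq, normSq_apply]
    simp only [add_re, one_re, exp_re, add_im, one_im, exp_im, zero_add]
    linear_combination Real.exp u.re ^ 2 * Real.sin_sq_add_cos_sq u.im
  have hcos : Real.cos u.im = 2 * Real.cos (u.im / 2) ^ 2 - 1 := by
    rw [← Real.cos_two_mul]; congr 1; ring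
  rw [e, hcos]
  have h1 := Real.cos_sq_le_one (u.im / 2)
  nlinarith [mul_nonneg (sub_nonneg.2 h1) (sq_nonneg (1 - Real.exp u.re))]

theorem cos_half_pos {b : ℝ} (h0 : 0 ≤ b) (hb : b < Real.pi) : 0 < Real.cos (b / 2) :=
  Real.cos_pos_of_mem_Ioo ⟨by linarith [Real.pi_pos], by linarith⟩

theorem one_add_exp_ne_zero {u : ℂ} (hu : |u.im| < Real.pi) : 1 + exp u ≠ 0 := by
  have h := cos_half_mul_le_norm_one_add_exp le_rfl hu.le
  have := cos_half_pos (abs_nonneg _) hu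
  exact norm_pos_iff.1 (lt_of_lt_of_le (by positivity) h)

theorem norm_inv_one_add_exp_le {u : ℂ} {b : ℝ} (hu : |u.im| ≤ b) (hb : b < Real.pi) :
    ‖(1 + exp u)⁻¹‖ ≤ (Real.cos (b / 2))⁻¹ := by
  have h := cos_half_mul_le_norm_one_add_exp hu hb.le
  have hc := cos_half_pos ((abs_nonneg _).trans hu) hb
  rw [norm_inv]
  refine inv_anti₀ hc (le_trans ?_ h)
  exact le_mul_of_one_le_right hc.le (by linarith [Real.exp_pos u.re])

theorem norm_dslope_le {f : ℂ → ℂ} {s : ℂ} {A B : ℝ} (hs : s ≠ 0) (h : ‖f s‖ ≤ A)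
    (h0 : ‖f 0‖ ≤ B) : ‖dslope f 0 s‖ ≤ (A + B) / ‖s‖ := by
  rw [dslope_of_ne _ hs, slope_def_field, norm_div, sub_zero]
  exact div_le_div_of_nonneg_right ((norm_sub_le _ _).trans (add_le_add h h0)) (norm_nonneg _)

theorem integrable_inv_one_add_exp_mul_stripKernel {w : ℂ} (hw : |w.im| < Real.pi) :
    Integrable fun t : ℝ => (1 + exp (t - w))⁻¹ * stripKernel 0 t := by
  refine (integrable_stripKernel (by simpa using Real.pi_pos)).bdd_mul
    (c := (Real.cos (|w.im| / 2))⁻¹) (Continuous.aestronglyMeasurable ?_)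
    (Eventually.of_forall fun t => norm_inv_one_add_exp_le (by simp) hw)
  exact Continuous.inv₀ (by fun_prop) fun t => one_add_exp_ne_zero (by simpa using hw)

/-- The average of the Fermi function `(1 + exp (t - w))⁻¹` against the Poisson kernel of the strip. -/
theorem integral_inv_one_add_exp_mul_stripKernel {w : ℂ} (hw : |w.im| < Real.pi) (hw0 : w ≠ 0) :
    ∫ t : ℝ, (1 + exp (t - w))⁻¹ * stripKernel 0 t =
      2 * Real.pi * I * ((1 - exp (-w))⁻¹ - w⁻¹) := by
  have hpi := Real.pi_pos
  obtain ⟨hw1, hw2⟩ := abs_lt.1 hw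
  -- `E` is `1/(1 - e^(s-w))` with its pole at `w` cancelled; `h(s) = (E(s) - E(0))/s` is then
  -- holomorphic near the closed strip and `O(1/|Re s|)`.
  set E : ℂ → ℂ := fun s => fermiRegular (s - w) with hE
  set h : ℂ → ℂ := dslope E 0 with hh
  set A : ℂ := (1 - exp (-w))⁻¹ with hA
  have hexp : exp (-w) ≠ 1 :=
    exp_ne_one_of_abs_im_lt (by rw [neg_im, abs_neg]; linarith) (neg_ne_zero.2 hw0)
  have hE0 : E 0 = A - w⁻¹ := by
    rw [hE, hA]; simp only [zero_sub]
    rw [fermiRegular_eq (neg_ne_zero.2 hw0) hexp, inv_neg, ← sub_eq_add_neg]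
  set U : Set ℂ := {s | |(s - w).im| < 2 * Real.pi} with hU
  have hUo : IsOpen U := isOpen_lt (by fun_prop) continuous_const
  have hU0 : (0 : ℂ) ∈ U := by
    simp only [hU, mem_ofPred_eq, zero_sub, neg_im, abs_neg]; linarith
  have hEd : DifferentiableOn ℂ E U :=
    differentiableOn_fermiRegular.comp (by fun_prop) fun s hs => hs
  have hd : DifferentiableOn ℂ h U :=
    (Complex.differentiableOn_dslope (hUo.mem_nhds hU0)).2 hEd
  have hstrip : {s : ℂ | |s.im| ≤ Real.pi} ⊆ U := fun s hs => by
    have hs' : |s.im| ≤ Real.pi := hs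
    obtain ⟨h1, h2⟩ := abs_le.1 hs'
    simp only [hU, mem_ofPred_eq, sub_im]
    exact abs_lt.2 ⟨by linarith, by linarith⟩
  have hlim := tendsto_integral_strip_boundary (hd.mono hstrip) (C := 3 + ‖E 0‖)
    (R := |w.re| + 1) fun s hs _ => by
      have hs0 : 0 < |s.re| := by linarith [abs_nonneg w.re]
      have hsne : s ≠ 0 := by rintro rfl; simp at hs0
      have h3 : ‖E s‖ ≤ 3 := norm_fermiRegular_le (by
        have := abs_sub_abs_le_abs_sub s.re w.re
        rw [sub_re]; linarith)
      refine (norm_dslope_le hsne h3 le_rfl).trans ?_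
      exact div_le_div_of_nonneg_left (by positivity) hs0 (abs_re_le_norm s)
  -- The last term comes from `1/(s-w) + 1/w = s / (w (s-w))`, whose factor `s` cancels the
  -- denominator of `h`.
  have hpt : ∀ t : ℝ, h (t - Real.pi * I) - h (t + Real.pi * I) =
      (1 + exp (t - w))⁻¹ * stripKernel 0 t - A * stripKernel 0 t + w⁻¹ * stripKernel w t := by
    have key : ∀ s : ℂ, s ≠ 0 → s - w ≠ 0 → exp (s - w) ≠ 1 →
        h s = ((1 - exp (s - w))⁻¹ - A) * s⁻¹ + w⁻¹ * (s - w)⁻¹ := by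
      intro s h0 h1 h2
      rw [hh, dslope_of_ne _ h0, slope_def_field, hE0, hE]
      simp only
      rw [fermiRegular_eq h1 h2]
      field_simp
      ring
    have hne : ∀ s : ℂ, |s.im| = Real.pi → s ≠ 0 ∧ s - w ≠ 0 ∧ exp (s - w) ≠ 1 := by
      intro s hs
      have a1 : s ≠ 0 := by rintro rfl; simp at hs; linarith
      have a2 : s - w ≠ 0 := by
        intro h; rw [sub_eq_zero.1 h] at hs; linarith
      exact ⟨a1, a2, exp_ne_one_of_abs_im_lt (hstrip hs.le) a2⟩
    intro t
    obtain ⟨a1, a2, a3⟩ := hne (t - Real.pi * I) (by simp [hpi.le])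
    obtain ⟨b1, b2, b3⟩ := hne (t + Real.pi * I) (by simp [hpi.le])
    have e1 : exp (t - Real.pi * I - w) = -exp (t - w) := by
      rw [sub_right_comm, exp_sub_pi_mul_I]
    have e2 : exp (t + Real.pi * I - w) = -exp (t - w) := by
      rw [add_sub_right_comm, exp_add_pi_mul_I]
    rw [key _ a1 a2 a3, key _ b1 b2 b3, e1, e2, stripKernel, stripKernel]
    simp only [sub_neg_eq_add, sub_zero]
    ring
  have i1 := integrable_inv_one_add_exp_mul_stripKernel hw
  have i2 := (integrable_stripKernel (a := 0) (by simpa using hpi)).const_mul A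
  have i3 := (integrable_stripKernel hw).const_mul w⁻¹
  have hlim2 := intervalIntegral_tendsto_integral ((i1.sub i2).add i3)
    tendsto_neg_atTop_atBot tendsto_id
  have h0 := tendsto_nhds_unique (hlim2.congr fun T => by
    refine intervalIntegral.integral_congr fun t _ => ?_
    exact (hpt t).symm) hlim
  have hs := integral_add (i1.sub i2) i3
  have hs2 := integral_sub i1 i2
  simp only [Pi.add_apply, Pi.sub_apply] at h0 hs hs2
  rw [hs, hs2, integral_const_mul, integral_const_mul, integral_stripKernel hw,
    integral_stripKernel (by simpa using hpi)] at h0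
  linear_combination h0

theorem integrable_inv_sq_add_pi_sq : Integrable fun t : ℝ => (t ^ 2 + Real.pi ^ 2)⁻¹ := by
  simpa [add_comm] using integrable_inv_sq_add_sq Real.pi_pos 0

theorem integral_inv_sq_add_pi_sq : ∫ t : ℝ, (t ^ 2 + Real.pi ^ 2)⁻¹ = 1 := by
  have h := integral_stripKernel (a := 0) (by simpa using Real.pi_pos)
  simp only [stripKernel_zero] at h
  rw [integral_const_mul] at h
  have h1 := mul_left_cancel₀ two_pi_I_ne_zero (h.trans (mul_one _).symm)
  exact ofReal_injective (integral_ofReal.symm.trans (h1.trans ofReal_one.symm))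

theorem integrable_inv_one_add_exp_mul {w : ℂ} (hw : |w.im| < Real.pi) :
    Integrable fun t : ℝ => (1 + exp (t - w))⁻¹ * ((t ^ 2 + Real.pi ^ 2)⁻¹ : ℝ) := by
  refine ((integrable_inv_one_add_exp_mul_stripKernel hw).const_mul (2 * Real.pi * I)⁻¹).congr
    (Eventually.of_forall fun t => ?_)
  simp only [stripKernel_zero]
  field_simp [two_pi_I_ne_zero]

theorem integral_inv_one_add_exp_mul {w : ℂ} (hw : |w.im| < Real.pi) (hw0 : w ≠ 0) :
    ∫ t : ℝ, (1 + exp (t - w))⁻¹ * ((t ^ 2 + Real.pi ^ 2)⁻¹ : ℝ) =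
      (1 - exp (-w))⁻¹ - w⁻¹ := by
  have h := integral_inv_one_add_exp_mul_stripKernel hw hw0
  simp only [stripKernel_zero, mul_left_comm _ (2 * Real.pi * I : ℂ)] at h
  rw [integral_const_mul] at h
  exact mul_left_cancel₀ two_pi_I_ne_zero h

/-! ### The logarithmic potential as a function of `w` -/

/-- Dividing by `h r` moves the value to `1`, so the branch cut of `log` plays no role. -/
theorem HasDerivAt.log_norm_of_complex {h : ℝ → ℂ} {h' : ℂ} {r : ℝ} (hd : HasDerivAt h h' r)
    (h0 : h r ≠ 0) : HasDerivAt (fun x => Real.log ‖h x‖) (h' / h r).re r := by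
  have d1 := (hd.div_const (h r)).clog_real (by rw [div_self h0]; exact one_mem_slitPlane)
  have d2 := (reCLM.hasFDerivAt.comp_hasDerivAt r d1).add_const (Real.log ‖h r‖)
  rw [div_self h0, div_one] at d2
  refine d2.congr_of_eventuallyEq ?_
  filter_upwards [hd.continuousAt.eventually_ne h0] with x hx
  simp only [Function.comp, reCLM_apply, log_re, norm_div]
  rw [Real.log_div (norm_ne_zero_iff.2 hx) (norm_ne_zero_iff.2 h0)]
  ring

/-- The integrand of the logarithmic potential in the coordinates `u = log ((1 + z) / z)` and
`t = log ((1 + x) / |x|)`. -/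
noncomputable def logKernel (u : ℂ) (t : ℝ) : ℝ :=
  (Real.log ‖1 + exp (u - t)‖ - Real.log (1 + Real.exp (-t))) * (t ^ 2 + Real.pi ^ 2)⁻¹

theorem logKernel_zero : logKernel 0 = 0 := by
  funext t
  have : (1 + exp (0 - t) : ℂ) = ((1 + Real.exp (-t) : ℝ) : ℂ) := by push_cast; simp
  rw [logKernel, this, Complex.norm_of_nonneg (by positivity), sub_self, zero_mul, Pi.zero_apply]

theorem abs_log_norm_one_add_exp_sub_le {u : ℂ} (hu : |u.im| < Real.pi) (t : ℝ) :
    |Real.log ‖1 + exp (u - t)‖ - Real.log (1 + Real.exp (-t))| ≤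
      |u.re| - Real.log (Real.cos (|u.im| / 2)) := by
  have hlow := cos_half_mul_le_norm_one_add_exp (u := u - t) (b := |u.im|) (by simp) hu.le
  have hc := cos_half_pos (abs_nonneg _) hu
  have hre : (u - t).re = u.re + -t := by simp [sub_eq_add_neg]
  have hup : ‖1 + exp (u - t)‖ ≤ 1 + Real.exp (u - t).re := by
    simpa [norm_exp] using norm_add_le 1 (exp (u - t))
  rw [hre, Real.exp_add] at hlow hup
  have hp : 0 < 1 + Real.exp (-t) := by positivity
  have hn : 0 < ‖1 + exp (u - t)‖ := norm_pos_iff.2 (one_add_exp_ne_zero (by simpa using hu))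
  have he1 : 1 ≤ Real.exp |u.re| := Real.one_le_exp (abs_nonneg _)
  have hclog : Real.log (Real.cos (|u.im| / 2)) ≤ 0 :=
    Real.log_nonpos hc.le (Real.cos_le_one _)
  have hup2 : ‖1 + exp (u - t)‖ ≤ Real.exp |u.re| * (1 + Real.exp (-t)) := by
    have := mul_le_mul_of_nonneg_right (Real.exp_le_exp.2 (le_abs_self u.re)) (Real.exp_pos (-t)).le
    linarith
  have hlow2 : Real.cos (|u.im| / 2) * (Real.exp (-|u.re|) * (1 + Real.exp (-t))) ≤
      ‖1 + exp (u - t)‖ := by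
    refine le_trans (mul_le_mul_of_nonneg_left ?_ hc.le) hlow
    have h1 := mul_le_mul_of_nonneg_right (Real.exp_le_exp.2 (neg_abs_le u.re))
      (Real.exp_pos (-t)).le
    have h2 : Real.exp (-|u.re|) ≤ 1 := Real.exp_le_one_iff.2 (neg_nonpos.2 (abs_nonneg _))
    linarith
  have l1 := Real.log_le_log hn hup2
  have l2 := Real.log_le_log (by positivity) hlow2
  rw [Real.log_mul (Real.exp_pos _).ne' hp.ne', Real.log_exp] at l1
  rw [Real.log_mul hc.ne' (by positivity), Real.log_mul (Real.exp_pos _).ne' hp.ne',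
    Real.log_exp] at l2
  exact abs_le.2 ⟨by linarith, by linarith⟩

theorem continuous_logKernel {u : ℂ} (hu : |u.im| < Real.pi) : Continuous (logKernel u) := by
  refine Continuous.mul (Continuous.sub ?_ ?_) (Continuous.inv₀ (by fun_prop) fun t => ?_)
  · exact Continuous.log (by fun_prop) fun t =>
      norm_ne_zero_iff.2 (one_add_exp_ne_zero (by simpa using hu))
  · exact Continuous.log (by fun_prop) fun t => by positivity
  · have := Real.pi_pos; positivity

theorem integrable_logKernel {u : ℂ} (hu : |u.im| < Real.pi) : Integrable (logKernel u) := by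
  refine (integrable_inv_sq_add_pi_sq.const_mul
    (|u.re| - Real.log (Real.cos (|u.im| / 2)))).mono'
    (continuous_logKernel hu).aestronglyMeasurable (Eventually.of_forall fun t => ?_)
  rw [logKernel, norm_mul, Real.norm_eq_abs, Real.norm_of_nonneg (by positivity)]
  exact mul_le_mul_of_nonneg_right (abs_log_norm_one_add_exp_sub_le hu t) (by positivity)

theorem hasDerivAt_logKernel {w : ℂ} {r : ℝ} (hr : |(r * w : ℂ).im| < Real.pi) (t : ℝ) :
    HasDerivAt (fun x : ℝ => logKernel (x * w) t)
      ((w * ((1 + exp (t - r * w))⁻¹ * ((t ^ 2 + Real.pi ^ 2)⁻¹ : ℝ))).re) r := by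
  have hne : 1 + exp (r * w - t) ≠ 0 := one_add_exp_ne_zero (by simpa using hr)
  have d0 : HasDerivAt (fun x : ℝ => (x * w - t : ℂ)) w r := by
    simpa using ((hasDerivAt_id r).ofReal_comp.mul_const w).sub_const (t : ℂ)
  have d := HasDerivAt.log_norm_of_complex (d0.cexp.const_add 1) hne
  have d2 := (d.sub_const (Real.log (1 + Real.exp (-t)))).mul_const (t ^ 2 + Real.pi ^ 2)⁻¹
  refine d2.congr_deriv ?_
  have e : exp (t - r * w) = (exp (r * w - t))⁻¹ := by rw [← exp_neg, neg_sub]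
  rw [← re_mul_ofReal, e, ← mul_assoc]
  congr 2
  have := exp_ne_zero (r * w - t)
  have h2 : exp (r * w - t) + 1 ≠ 0 := by rwa [add_comm]
  field_simp
  rw [add_comm]

theorem hasDerivAt_integral_logKernel {w : ℂ} {r : ℝ} (hr : |(r * w : ℂ).im| < Real.pi) :
    HasDerivAt (fun x : ℝ => ∫ t, logKernel (x * w) t)
      (∫ t : ℝ, (w * ((1 + exp (t - r * w))⁻¹ * ((t ^ 2 + Real.pi ^ 2)⁻¹ : ℝ))).re) r := by
  -- A margin below `π` makes the bound on the Fermi function uniform near `r`.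
  obtain ⟨b, hb1, hb2⟩ := exists_between hr
  have hS : {x : ℝ | |(x * w : ℂ).im| < b} ∈ 𝓝 r :=
    (isOpen_lt (by fun_prop) continuous_const).mem_nhds hb1
  refine (hasDerivAt_integral_of_dominated_loc_of_deriv_le (F := fun (x : ℝ) t => logKernel (x * w) t)
    (F' := fun (x : ℝ) (t : ℝ) =>
      (w * ((1 + exp (t - x * w))⁻¹ * ((t ^ 2 + Real.pi ^ 2)⁻¹ : ℝ))).re) hS
    (bound := fun t => ‖w‖ * ((Real.cos (b / 2))⁻¹ * (t ^ 2 + Real.pi ^ 2)⁻¹)) ?_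
    (integrable_logKernel hr) ?_ ?_ ?_ ?_).2
  · filter_upwards [hS] with x hx
    exact (continuous_logKernel (lt_trans hx hb2)).aestronglyMeasurable
  · exact ((integrable_inv_one_add_exp_mul hr).const_mul w).re.aestronglyMeasurable
  · refine Eventually.of_forall fun t x hx => ?_
    have hx' : |(x * w : ℂ).im| < b := hx
    refine (abs_re_le_norm _).trans ?_
    rw [norm_mul, norm_mul, Complex.norm_of_nonneg (by positivity)]
    gcongr
    exact norm_inv_one_add_exp_le (by simpa using hx'.le) hb2
  · exact (integrable_inv_sq_add_pi_sq.const_mul _).const_mul _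
  · exact Eventually.of_forall fun t x hx => hasDerivAt_logKernel (lt_trans hx hb2) t

theorem hasDerivAt_log_norm_expSlope {w : ℂ} {r : ℝ} (hr : |(r * w : ℂ).im| < Real.pi) :
    HasDerivAt (fun x : ℝ => Real.log ‖expSlope (x * w)‖)
      ((w * deriv expSlope (r * w) / expSlope (r * w)).re) r := by
  have d0 : HasDerivAt (fun x : ℝ => (x * w : ℂ)) w r := by
    simpa using (hasDerivAt_id r).ofReal_comp.mul_const w
  have d1 := (differentiable_expSlope (r * w)).hasDerivAt.comp r d0
  rw [mul_comm] at d1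
  exact HasDerivAt.log_norm_of_complex d1 (expSlope_ne_zero (by linarith [Real.pi_pos]))

theorem deriv_expSlope_div_expSlope {u : ℂ} (hu : |u.im| < 2 * Real.pi) (h0 : u ≠ 0) :
    deriv expSlope u / expSlope u = (1 - exp (-u))⁻¹ - u⁻¹ := by
  have h1 := sub_ne_zero.2 (exp_ne_one_of_abs_im_lt hu h0)
  have d : HasDerivAt (fun v => v * expSlope v) (1 * expSlope u + u * deriv expSlope u) u :=
    (hasDerivAt_id u).mul (differentiable_expSlope u).hasDerivAt
  have d2 : HasDerivAt (fun v => v * expSlope v) (exp u) u := by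
    simp only [mul_expSlope]
    exact (hasDerivAt_exp u).sub_const 1
  have e := d.unique d2
  have e2 : deriv expSlope u = (exp u - expSlope u) / u := by
    field_simp; linear_combination e
  have e3 : expSlope u = (exp u - 1) / u := by rw [← mul_expSlope]; field_simp
  have h2 := exp_ne_zero u
  rw [e2, e3, exp_neg]
  have h3 : 1 - (exp u)⁻¹ ≠ 0 := by
    intro h
    apply h1
    have : (exp u)⁻¹ = 1 := (sub_eq_zero.1 h).symm
    rw [inv_eq_one.1 this, sub_self]
  have h4 : (1 - (exp u)⁻¹)⁻¹ = exp u / (exp u - 1) := by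
    rw [inv_eq_one_div, div_eq_div_iff h3 h1]; field_simp
  rw [h4]
  field_simp

theorem integral_logKernel {w : ℂ} (hw : |w.im| < Real.pi) (hw0 : w ≠ 0) :
    ∫ t, logKernel w t = Real.log ‖expSlope w‖ := by
  have hmem : ∀ r ∈ Icc (0 : ℝ) 1, |(r * w : ℂ).im| < Real.pi := fun r hr => by
    rw [im_ofReal_mul, abs_mul, abs_of_nonneg hr.1]
    exact lt_of_le_of_lt (mul_le_of_le_one_left (abs_nonneg _) hr.2) hw
  set f : ℝ → ℝ := fun r => (∫ t, logKernel (r * w) t) - Real.log ‖expSlope (r * w)‖ with hf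
  have hd := fun r (hr : r ∈ Icc (0 : ℝ) 1) =>
    (hasDerivAt_integral_logKernel (hmem r hr)).sub (hasDerivAt_log_norm_expSlope (hmem r hr))
  -- The mean value theorem evaluates the derivative only at an interior `c`, where `c w ≠ 0` and
  -- both closed formulas apply and cancel.
  obtain ⟨c, hc, hslope⟩ := exists_hasDerivAt_eq_slope f _ one_pos
    (fun r hr => (hd r hr).continuousAt.continuousWithinAt)
    (fun r hr => hd r (Ioo_subset_Icc_self hr))
  have hcm := hmem c (Ioo_subset_Icc_self hc)
  have hc0 : (c * w : ℂ) ≠ 0 := mul_ne_zero (ofReal_ne_zero.2 hc.1.ne') hw0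
  have hre := reCLM.integral_comp_comm ((integrable_inv_one_add_exp_mul hcm).const_mul w)
  simp only [reCLM_apply] at hre
  rw [hre, integral_const_mul, integral_inv_one_add_exp_mul hcm hc0, mul_div_assoc,
    deriv_expSlope_div_expSlope (by linarith [Real.pi_pos]) hc0, sub_self] at hslope
  have h0 : f 0 = 0 := by simp [hf, logKernel_zero, expSlope_zero]
  have h1 : f 1 = 0 := by
    rw [h0] at hslope; simpa using hslope.symm
  simpa [hf, sub_eq_zero] using h1

/-! ### The change of variables `t = log ((1+x)/|x|)` -/

/-- If `(1+z)/z = y` were real with `y ≤ 0`, then `z = 1/(y-1)` would lie in `[-1,0)`. -/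
theorem one_add_div_mem_slitPlane {z : ℂ}
    (hz : z ∉ (fun x : ℝ => (x : ℂ)) '' Set.Icc (-1 : ℝ) 0) : (1 + z) / z ∈ slitPlane := by
  have hz0 : z ≠ 0 := by
    rintro rfl; exact hz ⟨0, by norm_num, by simp⟩
  by_contra h
  rw [mem_slitPlane_iff, not_or, not_lt, not_not] at h
  set y := ((1 + z) / z).re with hy
  have e : (1 + z) / z = (y : ℂ) := Complex.ext (by simp [hy]) (by simpa using h.2)
  have hy1 : y - 1 < 0 := by linarith [h.1]
  refine hz ⟨(y - 1)⁻¹, ⟨?_, (inv_neg''.2 hy1).le⟩, ?_⟩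
  · rw [← neg_neg (y - 1), inv_neg]
    exact neg_le_neg (inv_le_one_of_one_le₀ (by linarith [h.1]))
  · push_cast
    have : (z : ℂ) * (y - 1) = 1 := by rw [← e]; field_simp; ring
    exact (eq_inv_of_mul_eq_one_left this).symm

theorem hasDerivAt_log_one_add_div_neg {x : ℝ} (hx : x ∈ Ioo (-1 : ℝ) 0) :
    HasDerivAt (fun x : ℝ => Real.log ((1 + x) / -x)) (1 / ((1 + x) * |x|)) x := by
  have h1 : 0 < 1 + x := by linarith [hx.1]
  have h2 : 0 < -x := by linarith [hx.2]
  have d := (((hasDerivAt_id x).const_add 1).div (hasDerivAt_id x).neg h2.ne').log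
    (div_pos h1 h2).ne'
  refine d.congr_deriv ?_
  have := hx.2.ne
  rw [abs_of_neg hx.2]
  simp only [id, Pi.neg_apply, Pi.div_apply]
  field_simp
  ring

theorem injOn_log_one_add_div_neg :
    InjOn (fun x : ℝ => Real.log ((1 + x) / -x)) (Ioo (-1 : ℝ) 0) := by
  intro x hx y hy h
  have hx1 : 0 < 1 + x := by linarith [hx.1]
  have hx2 : 0 < -x := by linarith [hx.2]
  have hy1 : 0 < 1 + y := by linarith [hy.1]
  have hy2 : 0 < -y := by linarith [hy.2]
  have := Real.log_injOn_pos (div_pos hx1 hx2) (div_pos hy1 hy2) h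
  rw [div_eq_div_iff hx2.ne' hy2.ne'] at this
  linarith

theorem image_log_one_add_div_neg :
    (fun x : ℝ => Real.log ((1 + x) / -x)) '' Ioo (-1 : ℝ) 0 = univ := by
  refine eq_univ_of_forall fun t => ⟨-(1 + Real.exp t)⁻¹, ⟨?_, ?_⟩, ?_⟩
  · exact neg_lt_neg (inv_lt_one_of_one_lt₀ (by linarith [Real.exp_pos t]))
  · exact neg_lt_zero.2 (by positivity)
  · have e : (1 + -(1 + Real.exp t)⁻¹) / - -(1 + Real.exp t)⁻¹ = Real.exp t := by
      field_simp; ring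
    simp only
    rw [e, Real.log_exp]

theorem log_norm_sub_mul_geometricZeroDensity {z : ℂ}
    (hz : z ∉ (fun x : ℝ => (x : ℂ)) '' Set.Icc (-1 : ℝ) 0) {x : ℝ} (hx : x ∈ Ioo (-1 : ℝ) 0) :
    |1 / ((1 + x) * |x|)| • (logKernel (log ((1 + z) / z)) (Real.log ((1 + x) / -x)) +
      Real.log ‖z‖ * (Real.log ((1 + x) / -x) ^ 2 + Real.pi ^ 2)⁻¹) =
    Real.log ‖z - x‖ * geometricZeroDensity x := by
  have hx1 : 0 < 1 + x := by linarith [hx.1]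
  have hx2 : 0 < -x := by linarith [hx.2]
  have hx0 : x ≠ 0 := hx.2.ne
  have hz0 : z ≠ 0 := by
    rintro rfl; exact hz ⟨0, by norm_num, by simp⟩
  have hzx : z - x ≠ 0 := fun h => hz ⟨x, Ioo_subset_Icc_self hx, (sub_eq_zero.1 h).symm⟩
  have hq : (0 : ℝ) < (1 + x) / -x := div_pos hx1 hx2
  have e1 : Real.exp (-Real.log ((1 + x) / -x)) = -x / (1 + x) := by
    rw [Real.exp_neg, Real.exp_log hq, inv_div]
  have e2 : 1 + Real.exp (-Real.log ((1 + x) / -x)) = (1 + x)⁻¹ := by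
    rw [e1]; field_simp; ring
  have hx1' : (1 + x : ℂ) ≠ 0 := by exact_mod_cast hx1.ne'
  have e3 : 1 + exp (log ((1 + z) / z) - (Real.log ((1 + x) / -x) : ℝ)) =
      (z - x) / (z * ((1 + x : ℝ) : ℂ)) := by
    rw [sub_eq_add_neg, exp_add, exp_log (slitPlane_ne_zero (one_add_div_mem_slitPlane hz)),
      ← ofReal_neg, ← ofReal_exp, e1]
    push_cast
    field_simp
    ring
  rw [logKernel, e2, e3, norm_div, norm_mul, Complex.norm_of_nonneg hx1.le,
    Real.log_div (norm_ne_zero_iff.2 hzx) (by positivity),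
    Real.log_mul (norm_ne_zero_iff.2 hz0) hx1.ne', Real.log_inv, geometricZeroDensity,
    abs_of_pos (a := 1 / ((1 + x) * |x|)) (by positivity), abs_of_neg hx.2, smul_eq_mul,
    one_div, one_div, mul_inv ((1 + x) * -x)]
  ring

theorem mainTheorem9 (z : ℂ) (hz : z ∉ (fun x : ℝ => (x : ℂ)) '' Set.Icc (-1 : ℝ) 0) :
    IntervalIntegrable (fun x : ℝ => Real.log ‖z - (x : ℂ)‖ * geometricZeroDensity x)
      MeasureTheory.volume (-1) 0 ∧
    ∫ x in (-1 : ℝ)..0, Real.log ‖z - (x : ℂ)‖ * geometricZeroDensity x =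
      -Real.log ‖Complex.log ((1 + z) / z)‖ := by
  have hz0 : z ≠ 0 := by
    rintro rfl; exact hz ⟨0, by norm_num, by simp⟩
  have hsl := one_add_div_mem_slitPlane hz
  set w := log ((1 + z) / z) with hw
  have hexp : exp w = (1 + z) / z := exp_log (slitPlane_ne_zero hsl)
  have hwim : |w.im| < Real.pi := by
    rw [hw, log_im]
    exact abs_lt.2 ⟨neg_pi_lt_arg _, lt_of_le_of_ne (arg_le_pi _) (slitPlane_arg_ne_pi hsl)⟩
  have hw0 : w ≠ 0 := by
    intro h
    rw [h, exp_zero, eq_div_iff hz0, one_mul] at hexp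
    exact one_ne_zero (add_eq_right.1 hexp.symm)
  have hk := integrable_logKernel hwim
  have hc := integrable_inv_sq_add_pi_sq.const_mul (Real.log ‖z‖)
  have hder := fun x (hx : x ∈ Ioo (-1 : ℝ) 0) =>
    (hasDerivAt_log_one_add_div_neg hx).hasDerivWithinAt (s := Ioo (-1 : ℝ) 0)
  set G : ℝ → ℝ := fun t => logKernel w t + Real.log ‖z‖ * (t ^ 2 + Real.pi ^ 2)⁻¹ with hG
  have hGint : ∫ t, G t = -Real.log ‖w‖ := by
    -- `w · expSlope w = e^w - 1 = 1/z`.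
    have hs : expSlope w = (z * w)⁻¹ := by
      have := mul_expSlope w
      rw [hexp] at this
      field_simp at this ⊢
      linear_combination this
    rw [hG, integral_add hk hc, integral_const_mul, integral_inv_sq_add_pi_sq,
      integral_logKernel hwim hw0, hs, norm_inv, norm_mul, Real.log_inv,
      Real.log_mul (norm_ne_zero_iff.2 hz0) (norm_ne_zero_iff.2 hw0)]
    ring
  have hcongr : ∀ x ∈ Ioo (-1 : ℝ) 0, |1 / ((1 + x) * |x|)| • G (Real.log ((1 + x) / -x)) =
      Real.log ‖z - x‖ * geometricZeroDensity x :=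
    fun x hx => log_norm_sub_mul_geometricZeroDensity hz hx
  constructor
  · rw [intervalIntegrable_iff_integrableOn_Ioo_of_le (by norm_num)]
    refine IntegrableOn.congr_fun ?_ hcongr measurableSet_Ioo
    rw [← integrableOn_image_iff_integrableOn_abs_deriv_smul measurableSet_Ioo hder
      injOn_log_one_add_div_neg, image_log_one_add_div_neg, integrableOn_univ]
    exact hk.add hc
  · rw [intervalIntegral.integral_of_le (by norm_num), integral_Ioc_eq_integral_Ioo,
      ← setIntegral_congr_fun measurableSet_Ioo hcongr,
      ← integral_image_eq_integral_abs_deriv_smul measurableSet_Ioo hder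
      injOn_log_one_add_div_neg, image_log_one_add_div_neg, setIntegral_univ, hGint]
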